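/- Let $D$ be an oriented virtual link diagram, i.e. a generically immersed oriented closed 1-manifold in the plane whose double points are marked as classical (over/under) or virtual crossings. Assume that $D$ is checkerboard colorable: one can color a small neighbourhood of one side of each arc so that the coloring alternates around every classical crossing (of the four quadrants exactly two opposite ones are colored) and passes straight along each of the two strands at every virtual crossing. The arrow polynomial of $D$ is defined as follows. Each classical crossing has an oriented smoothing and a disoriented smoothing; the disoriented smoothing produces two cusps, one joining the two incoming ends and one joining the two outgoing ends, and the inside of a cusp is its acute angle. At a positive crossing the oriented smoothing has coefficient $A$ and the disoriented one $A^{-1}$; at a negative crossing these coefficients are exchanged. A state $S$ is a choice of smoothing at every classical crossing. Each circle of $S$ is reduced by cancelling consecutive cusps whose insides lie on the same side of the circle until the cusps alternate in type; if $2n$ cusps remain, the circle contributes the variable $K_n$ when $n\ge 1$ and the factor $1$ when $n=0$, and $\langle S\rangle$ is the product of these contributions. With $|S|$ the number of circles of $S$, $\alpha$ and $\beta$ the numbers of smoothings in $S$ with coefficient $A$ and $A^{-1}$, $d=-A^2-A^{-2}$, and $\omega(D)$ the writhe (the sum of the signs of the classical crossings), put $$\langle D\rangle_{NA}=(-A^3)^{-\omega(D)}\sum_S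 A^{\alpha-\beta}d^{|S|-1}\langle S\rangle\in\mathbb Z[A,A^{-1}][K_1,K_2,\dots].$$ A summand of $\langle D\rangle_{NA}$ is a monomial $A^sK_{i_1}^{j_1}\cdots K_{i_v}^{j_v}$ with $v\ge 0$, $1\le i_1<\cdots<i_v$ and all $j_t\ge 1$ that occurs in it with nonzero integer coefficient; its $k$-degree is $\sum_{t=1}^v i_tj_t$. Let $AS(D)$ be the set of the $k$-degrees of all summands. Theorem 4.1. Let $D$ be an oriented checkerboard colorable virtual link diagram. Then (1) $AS(D)$ contains only even integers; and (2) for every summand $A^sK_{i_1}^{j_1}K_{i_2}^{j_2}\cdots K_{i_v}^{j_v}$ of $\langle D\rangle_{NA}$ with $v\ge1$, $1\le i_1<i_2<\cdots<i_v$ and $j_t\ge1$ for $t=1,\dots,v$, we have $2i_v\le\sum_{t=1}^v i_tj_t$. In particular, $\langle D\rangle_{NA}$ has no summand of the form $A^sK_i$ with $i\ge1$. -/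

import Mathlib

open scoped LaurentPolynomial

/-- Left or right, with respect to a direction of travel. -/
inductive Side
  | left
  | right
  deriving DecidableEq

instance : Fintype Side := ⟨{.left, .right}, by intro x; cases x <;> simp⟩

/-- The four ends of strands at a crossing of an oriented diagram. Every crossing is drawn so that
both of its strands run upwards: the strands are `sw → ne` and `se → nw`. The counterclockwise
order of the four ends around the crossing is `sw, se, ne, nw`. -/
inductive Corner
  | sw
  | se
  | ne
  | nw
  deriving DecidableEq

instance : Fintype Corner := ⟨{.sw, .se, .ne, .nw}, by intro x; cases x <;> simp⟩

/-- The next end in counterclockwise order around a crossing. -/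
def Corner.ccw : Corner → Corner
  | .sw => .se
  | .se => .ne
  | .ne => .nw
  | .nw => .sw

/-- The incoming end of a crossing on the given side. -/
def Corner.incoming : Side → Corner
  | .left => .sw
  | .right => .se

/-- The outgoing end of a crossing on the given side. -/
def Corner.outgoing : Side → Corner
  | .left => .nw
  | .right => .ne

/-- The combinatorial data of a generically immersed oriented closed 1-manifold whose double points
are marked as classical or virtual crossings. -/
structure DiagramData where
  /-- number of classical crossings -/
  numClassical : ℕ
  /-- number of virtual crossings -/
  numVirtual : ℕ
  /-- number of components without any crossing, classical or virtual -/
  numLoops : ℕ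
  /-- The sign of each classical crossing: at a positive crossing the strand `sw → ne` passes over,
  at a negative crossing the strand `se → nw` does. -/
  sign : Fin numClassical → ℤˣ
  /-- The arcs: the arc which leaves crossing `c` through its outgoing end on side `x` enters
  crossing `(next (c, x)).1` through its incoming end on side `(next (c, x)).2`. -/
  next : (Fin numClassical ⊕ Fin numVirtual) × Side ≃ (Fin numClassical ⊕ Fin numVirtual) × Side

namespace DiagramData

variable (D : DiagramData)

/-- The crossings, classical and virtual. -/
abbrev Crossing : Type := Fin D.numClassical ⊕ Fin D.numVirtual

/-- The ends of arcs; each arc running between crossings has two. -/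
abbrev ArcEnd : Type := D.Crossing × Corner

/-- The opposite end of the arc which has the given end. -/
def arc : D.ArcEnd → D.ArcEnd
  | (c, .nw) => ((D.next (c, .left)).1, .incoming (D.next (c, .left)).2)
  | (c, .ne) => ((D.next (c, .right)).1, .incoming (D.next (c, .right)).2)
  | (c, .sw) => ((D.next.symm (c, .left)).1, .outgoing (D.next.symm (c, .left)).2)
  | (c, .se) => ((D.next.symm (c, .right)).1, .outgoing (D.next.symm (c, .right)).2)

/-- The faces of the 4-valent ribbon graph whose vertices are all the crossings: to walk along a
face, follow an arc to its opposite end and continue from the neighbouring end there. -/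
def Face : Type :=
  Quot fun e e' : D.ArcEnd => e' = ((D.arc e).1, (D.arc e).2.ccw)

/-- The connected components of the 4-valent graph whose vertices are all the crossings. -/
def GraphComponent : Type :=
  Quot fun e e' : D.ArcEnd => e' = D.arc e ∨ e'.1 = e.1

/-- The diagram can be drawn in the plane without further crossings: Euler's formula
`V - E + F = 2 C` with `E = 2 V` holds for the graph whose vertices are all the crossings. -/
def IsPlanar : Prop :=
  Nat.card D.Face = Nat.card D.Crossing + 2 * Nat.card D.GraphComponent

end DiagramData

/-- An oriented virtual link diagram (up to isotopy), given by its planar combinatorial data. -/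
structure VirtualLinkDiagram extends DiagramData where
  planar : toDiagramData.IsPlanar

/-- The two smoothings of a classical crossing: the oriented one joins `sw` to `nw` and `se` to
`ne`, the disoriented one joins `sw` to `se` and `nw` to `ne`. -/
inductive Smoothing
  | oriented
  | disoriented
  deriving DecidableEq

instance : Fintype Smoothing := ⟨{.oriented, .disoriented}, by intro x; cases x <;> simp⟩

/-- Reduction of a word of cusps. A cusp is recorded by the side on which its inside (its acute
angle) lies as one travels along the circle; two consecutive cusps cancel when their insides lie on
the same side. The result alternates between the two sides. In particular, if the given word has
even length then the first and last letters of the result differ, so that no further cancellation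
is possible around the circle. -/
def reduceCusps : List Side → List Side
  | [] => []
  | a :: w =>
    match reduceCusps w with
    | [] => [a]
    | b :: t => if a = b then t else a :: b :: t

/-- The ring `ℤ[A, A⁻¹][K₁, K₂, …]`; the variable `A` is `LaurentPolynomial.T 1`. -/
abbrev ArrowRing : Type := MvPolynomial ℕ+ ℤ[T;T⁻¹]

/-- The unit `-A³` of `ℤ[A, A⁻¹]`. -/
noncomputable def negACubed : ℤ[T;T⁻¹]ˣ where
  val := -LaurentPolynomial.T 3
  inv := -LaurentPolynomial.T (-3)
  val_inv := by rw [neg_mul_neg, ← LaurentPolynomial.T_add]; simp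
  inv_val := by rw [neg_mul_neg, ← LaurentPolynomial.T_add]; simp

/-- The variable `K n` for `n ≥ 1`; the trivial circle graph `n = 0` contributes `1`. -/
noncomputable def kVar (n : ℕ) : ArrowRing :=
  if h : 0 < n then MvPolynomial.X ⟨n, h⟩ else 1

/-- The loop value `d = -A² - A⁻²`. -/
noncomputable def loopValue : ℤ[T;T⁻¹] := -LaurentPolynomial.T 2 - LaurentPolynomial.T (-2)

/-- The `k`-degree `i₁ j₁ + ⋯ + iᵥ jᵥ` of the monomial `K_{i₁}^{j₁} ⋯ K_{iᵥ}^{jᵥ}`, which is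
encoded by the function taking `iₜ` to `jₜ` and every other index to `0`. -/
def kDegree (m : ℕ+ →₀ ℕ) : ℕ := m.sum fun i j => (i : ℕ) * j

namespace VirtualLinkDiagram

variable (D : VirtualLinkDiagram)

/-- The writhe. -/
def writhe : ℤ := ∑ c, (D.sign c : ℤ)

/-- `D` has a checkerboard colouring. A colouring chooses for each arc, here at both of its ends,
the side (with respect to the orientation of the arc) which is coloured. At a classical crossing the
colouring alternates: of the four quadrants, either the north and south ones are coloured (this is
the case `right, left, right, left` for the ends `sw, se, nw, ne`) or the west and east ones (the
case `left, right, left, right`). At a virtual crossing the colouring goes straight through along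
each of the two strands. Components without crossings can be coloured arbitrarily. -/
def CheckerboardColorable : Prop :=
  ∃ col : D.ArcEnd → Side,
    (∀ e, col (D.arc e) = col e) ∧
    (∀ c : Fin D.numClassical,
      col (.inl c, .sw) ≠ col (.inl c, .se) ∧
      col (.inl c, .nw) = col (.inl c, .sw) ∧
      col (.inl c, .ne) = col (.inl c, .se)) ∧
    (∀ c : Fin D.numVirtual,
      col (.inr c, .ne) = col (.inr c, .sw) ∧
      col (.inr c, .nw) = col (.inr c, .se))

/-- An (unreduced) oriented bracket state: a choice of smoothing at each classical crossing. -/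
abbrev State : Type := Fin D.numClassical → Smoothing

namespace State

variable {D} (S : D.State)

/-- The smoothing chosen at `c` has coefficient `A` in the oriented state expansion: a positive
crossing is `A` times the oriented plus `A⁻¹` times the disoriented smoothing, a negative crossing
is `A⁻¹` times the oriented plus `A` times the disoriented smoothing. -/
def IsA (c : Fin D.numClassical) : Prop :=
  (D.sign c = 1 ∧ S c = .oriented) ∨ (D.sign c = -1 ∧ S c = .disoriented)

/-- The number of smoothings with coefficient `A`. -/
noncomputable def alpha : ℕ := Nat.card {c // S.IsA c}

/-- The number of smoothings with coefficient `A⁻¹`. -/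
noncomputable def beta : ℕ := Nat.card {c // ¬ S.IsA c}

/-- The end with which the given end is joined at its crossing in the state. -/
def join : D.ArcEnd → D.ArcEnd
  | (.inr c, .sw) => (.inr c, .ne)
  | (.inr c, .ne) => (.inr c, .sw)
  | (.inr c, .se) => (.inr c, .nw)
  | (.inr c, .nw) => (.inr c, .se)
  | (.inl c, x) =>
    (.inl c, match S c, x with
      | .oriented, .sw => .nw
      | .oriented, .nw => .sw
      | .oriented, .se => .ne
      | .oriented, .ne => .se
      | .disoriented, .sw => .se
      | .disoriented, .se => .sw
      | .disoriented, .nw => .ne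
      | .disoriented, .ne => .nw)

/-- The cusp, if any, that is passed on arriving at a crossing through the given end; it is recorded
by the side on which its inside lies. For the cusp joining `sw` and `se` the inside is the south
quadrant, for the one joining `nw` and `ne` it is the north quadrant. -/
def cusp? : D.ArcEnd → Option Side
  | (.inr _, _) => none
  | (.inl c, x) =>
    match S c, x with
    | .oriented, _ => none
    | .disoriented, .sw => some .right
    | .disoriented, .se => some .left
    | .disoriented, .nw => some .left
    | .disoriented, .ne => some .right

/-- One step along a state circle: leave a crossing through the given end, follow the arc to its
opposite end, and pass through the smoothed or virtual crossing there. -/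
def step (e : D.ArcEnd) : D.ArcEnd := S.join (D.arc e)

/-- The circle graphs of the state which pass through crossings: the classes of arc ends generated
by being opposite ends of one arc and by being joined at a crossing. -/
def Circle : Type := Quot fun e e' : D.ArcEnd => e' = D.arc e ∨ e' = S.join e

/-- The cusps met when going once around a state circle, starting from the given end. -/
noncomputable def cuspWord (e : D.ArcEnd) : List Side :=
  (List.range (Function.minimalPeriod S.step e)).filterMap fun k => S.cusp? (D.arc (S.step^[k] e))

/-- The number `n` such that the circle graph through the given end reduces to the circle graph
with `2 n` cusps alternating in type. -/
noncomputable def index (e : D.ArcEnd) : ℕ := (reduceCusps (S.cuspWord e)).length / 2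

/-- The number `|S|` of circle graphs in the state, trivial or not. -/
noncomputable def numCircles : ℕ := Nat.card S.Circle + D.numLoops

/-- The product `⟨S⟩` of the variables `K n` of the circle graphs in the state (the starting point
and the direction in which a circle graph is read do not matter). Components of the diagram
without crossings are trivial circle graphs. -/
noncomputable def kProduct : ArrowRing := ∏ᶠ γ : S.Circle, kVar (S.index (Quot.out γ))

end State

/-- The arrow polynomial `∑_S A^(α-β) d^(|S|-1) ⟨S⟩`. (Every state of a nonempty diagram has
`|S| ≥ 1`.) -/
noncomputable def arrowPolynomial : ArrowRing :=
  ∑ S : D.State,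
    MvPolynomial.C (LaurentPolynomial.T ((State.alpha S : ℤ) - (State.beta S : ℤ)) *
      loopValue ^ (State.numCircles S - 1)) * State.kProduct S

/-- The normalized arrow polynomial `(-A³)^(-w)` times the arrow polynomial. -/
noncomputable def normalizedArrowPolynomial : ArrowRing :=
  MvPolynomial.C ((negACubed ^ (-D.writhe) : ℤ[T;T⁻¹]ˣ) : ℤ[T;T⁻¹]) * D.arrowPolynomial

/-- `A^s` times the monomial `m` in the variables `K` is a summand of the normalized arrow
polynomial, that is, it occurs in it with nonzero integer coefficient. -/
def IsSummand (s : ℤ) (m : ℕ+ →₀ ℕ) : Prop :=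
  (MvPolynomial.coeff m D.normalizedArrowPolynomial).coeff s ≠ 0

/-- The set `AS(D)` of the `k`-degrees of the summands of the normalized arrow polynomial. -/
def AS : Set ℕ := {k | ∃ s m, D.IsSummand s m ∧ kDegree m = k}

end VirtualLinkDiagram

/-! Along a state circle, each cusp reverses the direction of travel relative to the orientation of
`D`, and it also swaps the coloured side relative to that orientation. So the coloured side as seen
by the traveller is constant on each circle (`toInt_mul_toInt_col_step`). Weighted by colour, the
cusp signs therefore add up along a circle to plus or minus the alternating sum of its cusp word,
whose absolute value is twice the index (`natAbs_altSum_cuspWord`). The two cusps of a disoriented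
smoothing have opposite weights, so the sum over all circles vanishes (`sum_contribution`). Hence
the indices of a state can be given signs with total zero (`exists_signed_index`): their sum is even
and none exceeds the sum of the others. Every summand carries the K-monomial of some state, so both
properties pass to it. -/

/-- The sign of a side: `1` for left and `-1` for right. -/
def Side.toInt : Side → ℤ
  | .left => 1
  | .right => -1

/-- The sign of an end of an arc: `1` if one leaves a crossing there along the orientation, `-1` if
one leaves against it. -/
def Corner.toInt : Corner → ℤ
  | .sw => -1
  | .se => -1
  | .ne => 1
  | .nw => 1

/-- The sign of an optional cusp, `0` if there is none. -/
def cuspInt : Option Side → ℤ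
  | none => 0
  | some x => x.toInt

lemma Side.toInt_mul_self (x : Side) : x.toInt * x.toInt = 1 := by cases x <;> rfl

lemma Side.toInt_of_ne {x y : Side} (h : x ≠ y) : x.toInt = -y.toInt := by
  cases x <;> cases y <;> simp_all [Side.toInt]

lemma Corner.toInt_mul_self (x : Corner) : x.toInt * x.toInt = 1 := by cases x <;> rfl

/-! ### Reduced length of a cusp word as an alternating sum -/

/-- The alternating sum of the signs of the letters of a word of cusps. -/
def altSum : List Side → ℤ
  | [] => 0
  | a :: w => a.toInt - altSum w

/-- Equal neighbours enter with opposite signs, and deleting both keeps the position parity of all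
other letters. -/
lemma altSum_reduceCusps (w : List Side) : altSum (reduceCusps w) = altSum w := by
  induction w with
  | nil => rfl
  | cons a w ih =>
    rw [altSum, ← ih, reduceCusps]
    split
    · next h => simp [h, altSum]
    · next b t h =>
      rw [h]
      split_ifs with hab
      · subst hab; simp [altSum]
      · simp [altSum]

lemma even_length_reduceCusps (w : List Side) :
    Even (reduceCusps w).length ↔ Even w.length := by
  induction w with
  | nil => rfl
  | cons a w ih =>
    rw [List.length_cons, Nat.even_add_one, ← ih, reduceCusps]
    split
    · next h => simp [h]
    · next b t h =>
      rw [h]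
      split_ifs with hab <;> simp [Nat.even_add_one]

lemma isChain_reduceCusps (w : List Side) : (reduceCusps w).IsChain (· ≠ ·) := by
  induction w with
  | nil => simp [reduceCusps]
  | cons a w ih =>
    rw [reduceCusps]
    split
    · simp
    · next b t h =>
      rw [h] at ih
      split_ifs with hab
      · exact ih.tail
      · exact List.isChain_cons_cons.2 ⟨hab, ih⟩

lemma altSum_of_isChain (a : Side) (w : List Side) (h : (a :: w).IsChain (· ≠ ·)) :
    altSum (a :: w) = a.toInt * (w.length + 1) := by
  induction w generalizing a with
  | nil => simp [altSum]
  | cons b w ih =>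
    obtain ⟨hab, h⟩ := List.isChain_cons_cons.1 h
    rw [altSum, ih b h, Side.toInt_of_ne hab]
    push_cast [List.length_cons]
    ring

lemma natAbs_altSum (w : List Side) : (altSum w).natAbs = (reduceCusps w).length := by
  rw [← altSum_reduceCusps]
  have h := isChain_reduceCusps w
  cases hw : reduceCusps w with
  | nil => rfl
  | cons a t =>
    rw [hw] at h
    rw [altSum_of_isChain a t h, Int.natAbs_mul]
    have : a.toInt.natAbs = 1 := by cases a <;> rfl
    rw [this, List.length_cons]
    omega

/-! ### Travelling along state circles -/

namespace DiagramData

variable (D : DiagramData)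

lemma arc_arc (e : D.ArcEnd) : D.arc (D.arc e) = e := by
  have key : ∀ (p : D.Crossing × Side), D.arc (p.1, .incoming p.2) =
      ((D.next.symm p).1, .outgoing (D.next.symm p).2) := by
    rintro ⟨c, x⟩; cases x <;> rfl
  have key' : ∀ (p : D.Crossing × Side), D.arc (p.1, .outgoing p.2) =
      ((D.next p).1, .incoming (D.next p).2) := by
    rintro ⟨c, x⟩; cases x <;> rfl
  obtain ⟨c, x⟩ := e
  cases x
  · exact (key' (D.next.symm (c, .left))).trans (by simp [Corner.incoming])
  · exact (key' (D.next.symm (c, .right))).trans (by simp [Corner.incoming])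
  · exact (key (D.next (c, .right))).trans (by simp [Corner.outgoing])
  · exact (key (D.next (c, .left))).trans (by simp [Corner.outgoing])

lemma toInt_arc (e : D.ArcEnd) : (D.arc e).2.toInt = -e.2.toInt := by
  have hi : ∀ x, (Corner.incoming x).toInt = -1 := by intro x; cases x <;> rfl
  have ho : ∀ x, (Corner.outgoing x).toInt = 1 := by intro x; cases x <;> rfl
  obtain ⟨c, x⟩ := e
  cases x <;> simp only [arc, hi, ho] <;> rfl

end DiagramData

namespace VirtualLinkDiagram

namespace State

variable {D : VirtualLinkDiagram} (S : D.State)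

lemma join_join (e : D.ArcEnd) : S.join (S.join e) = e := by
  obtain ⟨c | c, x⟩ := e
  · cases h : S c <;> cases x <;> simp [join, h]
  · cases x <;> rfl

/-- Two joined ends are both incoming or both outgoing exactly if they are joined by a cusp. -/
lemma toInt_join (e : D.ArcEnd) :
    (S.join e).2.toInt = if (S.cusp? e).isSome then e.2.toInt else -e.2.toInt := by
  obtain ⟨c | c, x⟩ := e
  · cases h : S c <;> cases x <;> simp [join, cusp?, h, Corner.toInt]
  · cases x <;> simp [join, cusp?, Corner.toInt]

lemma toInt_step (e : D.ArcEnd) :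
    (S.step e).2.toInt = if (S.cusp? (D.arc e)).isSome then -e.2.toInt else e.2.toInt := by
  rw [step, toInt_join, D.toInt_arc]
  simp

lemma cuspInt_join (e : D.ArcEnd) :
    cuspInt (S.cusp? (S.join e)) = -cuspInt (S.cusp? e) := by
  obtain ⟨c | c, x⟩ := e
  · cases h : S c <;> cases x <;> simp [join, cusp?, h, cuspInt, Side.toInt]
  · cases x <;> simp [join, cusp?, cuspInt]

/-- The permutation of the arc ends by which one travels along the state circles. -/
def stepPerm : Equiv.Perm D.ArcEnd where
  toFun := S.step
  invFun e := D.arc (S.join e)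
  left_inv e := by simp only [step, join_join, D.arc_arc]
  right_inv e := by simp only [step, D.arc_arc, join_join]

/-- The circle graph through a given arc end. -/
def circleOf (e : D.ArcEnd) : S.Circle := Quot.mk _ e

lemma sameCycle_step {e e' : D.ArcEnd} :
    S.stepPerm.SameCycle e (S.step e') ↔ S.stepPerm.SameCycle e e' :=
  Equiv.Perm.sameCycle_apply_right (f := S.stepPerm)

/-- Two arc ends on the same state circle are met when travelling in the same direction, or in
opposite directions. -/
lemma sameCycle_or_of_circleOf_eq {e e' : D.ArcEnd} (h : S.circleOf e = S.circleOf e') :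
    S.stepPerm.SameCycle e e' ∨ S.stepPerm.SameCycle e (D.arc e') := by
  let P : S.Circle → Prop := Quot.lift
    (fun e' => S.stepPerm.SameCycle e e' ∨ S.stepPerm.SameCycle e (D.arc e')) (by
      -- Replacing an end by its `arc` or its `join` only exchanges the two directions, so the
      -- disjunction descends to the quotient.
      rintro a b (rfl | rfl)
      · rw [D.arc_arc]; exact propext or_comm
      · have h1 : S.stepPerm.SameCycle e (S.join a) ↔ S.stepPerm.SameCycle e (D.arc a) := by
          rw [← sameCycle_step (e' := D.arc a), step, D.arc_arc]
        have h2 : S.stepPerm.SameCycle e (D.arc (S.join a)) ↔ S.stepPerm.SameCycle e a := by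
          rw [← sameCycle_step (e' := D.arc (S.join a)), step, D.arc_arc, join_join]
        rw [h1, h2]
        exact propext or_comm)
  have h0 : P (S.circleOf e) := Or.inl (Equiv.Perm.SameCycle.refl _ _)
  rw [h] at h0
  exact h0

lemma circleOf_arc (e : D.ArcEnd) : S.circleOf (D.arc e) = S.circleOf e :=
  Eq.symm (Quot.sound (r := fun e e' : D.ArcEnd => e' = D.arc e ∨ e' = S.join e) (Or.inl rfl))

lemma circleOf_join (e : D.ArcEnd) : S.circleOf (S.join e) = S.circleOf e :=
  Eq.symm (Quot.sound (r := fun e e' : D.ArcEnd => e' = D.arc e ∨ e' = S.join e) (Or.inr rfl))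

lemma circleOf_step (e : D.ArcEnd) : S.circleOf (S.step e) = S.circleOf e := by
  rw [step, circleOf_join, circleOf_arc]

/-- The cusps met in the first `n` steps from a given arc end. -/
def cuspWordOfLength (n : ℕ) (e : D.ArcEnd) : List Side :=
  (List.range n).filterMap fun k => S.cusp? (D.arc (S.step^[k] e))

lemma cuspWordOfLength_succ (n : ℕ) (e : D.ArcEnd) :
    S.cuspWordOfLength (n + 1) e =
      (S.cusp? (D.arc e)).toList ++ S.cuspWordOfLength n (S.step e) := by
  rw [cuspWordOfLength, List.range_succ_eq_map, List.filterMap_cons, List.filterMap_map]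
  cases h : S.cusp? (D.arc e) <;> simp [h, cuspWordOfLength, Function.comp_def]

lemma toInt_iterate_step (n : ℕ) (e : D.ArcEnd) :
    (S.step^[n] e).2.toInt = e.2.toInt * (-1) ^ (S.cuspWordOfLength n e).length := by
  induction n generalizing e with
  | zero => simp [cuspWordOfLength]
  | succ n ih =>
    rw [Function.iterate_succ_apply, ih, cuspWordOfLength_succ, toInt_step]
    cases h : S.cusp? (D.arc e) <;> simp [pow_succ]

/-- The orientation sign flips exactly at cusps, so it supplies the alternating signs of `altSum`.
-/
lemma sum_iterate_step (n : ℕ) (e : D.ArcEnd) :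
    ∑ k ∈ Finset.range n,
        (S.step^[k] e).2.toInt * cuspInt (S.cusp? (D.arc (S.step^[k] e))) =
      e.2.toInt * altSum (S.cuspWordOfLength n e) := by
  induction n generalizing e with
  | zero => simp [cuspWordOfLength, altSum]
  | succ n ih =>
    rw [Finset.sum_range_succ', cuspWordOfLength_succ]
    simp only [Function.iterate_succ_apply, Function.iterate_zero, id]
    rw [ih, toInt_step]
    cases h : S.cusp? (D.arc e)
    · simp [cuspInt]
    · simp [cuspInt, altSum]; ring

/-- A full turn restores the orientation sign, which every cusp reverses. This makes the halving in
`index` exact. -/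
lemma even_length_cuspWord (e : D.ArcEnd) : Even (S.cuspWord e).length := by
  have h := S.toInt_iterate_step (Function.minimalPeriod S.step e) e
  rw [Function.iterate_minimalPeriod] at h
  have h' : (-1 : ℤ) ^ (S.cuspWord e).length = 1 := by
    have := congrArg (e.2.toInt * ·) h
    simp only [← mul_assoc, Corner.toInt_mul_self, one_mul] at this
    exact this.symm
  exact (neg_one_pow_eq_one_iff_even (by norm_num)).1 h'

lemma natAbs_altSum_cuspWord (e : D.ArcEnd) :
    (altSum (S.cuspWord e)).natAbs = 2 * S.index e := by
  rw [natAbs_altSum, index]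
  exact (Nat.two_mul_div_two_of_even
    ((even_length_reduceCusps _).2 (S.even_length_cuspWord e))).symm

lemma sum_orbit (e : D.ArcEnd) (F : D.ArcEnd → ℤ) [DecidablePred (S.stepPerm.SameCycle e)] :
    ∑ a with S.stepPerm.SameCycle e a, F a =
      ∑ k ∈ Finset.range (Function.minimalPeriod S.step e), F (S.step^[k] e) := by
  have hpow : ∀ k, (S.stepPerm ^ k) e = S.step^[k] e := fun k => by
    rw [Equiv.Perm.coe_pow]; rfl
  symm
  refine Finset.sum_nbij (fun k => S.step^[k] e) ?_ ?_ ?_ (fun _ _ => rfl)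
  · intro k _
    exact Finset.mem_filter.2 ⟨Finset.mem_univ _, ⟨k, by rw [zpow_natCast, hpow]⟩⟩
  · rw [Finset.coe_range]
    exact Function.iterate_injOn_Iio_minimalPeriod
  · intro a ha
    obtain ⟨k, hk⟩ := (Finset.mem_filter.1 ha).2.exists_nat_pow_eq
    have hper : e ∈ Function.periodicPts S.step :=
      Function.Injective.mem_periodicPts S.stepPerm.injective e
    refine ⟨k % Function.minimalPeriod S.step e, ?_, ?_⟩
    · exact Finset.mem_coe.2 <| Finset.mem_range.2 <|
        Nat.mod_lt _ (Function.minimalPeriod_pos_of_mem_periodicPts hper)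
    · rw [← hk, hpow]
      exact Function.iterate_mod_minimalPeriod_eq

/-! ### Checkerboard colourings and weighted cusps -/

/-- The conditions on a checkerboard colouring. -/
def IsColouring (col : D.ArcEnd → Side) : Prop :=
  (∀ e, col (D.arc e) = col e) ∧
    (∀ c : Fin D.numClassical,
      col (.inl c, .sw) ≠ col (.inl c, .se) ∧
      col (.inl c, .nw) = col (.inl c, .sw) ∧
      col (.inl c, .ne) = col (.inl c, .se)) ∧
    (∀ c : Fin D.numVirtual,
      col (.inr c, .ne) = col (.inr c, .sw) ∧
      col (.inr c, .nw) = col (.inr c, .se))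

/-- The signed contribution of the cusp which is met after leaving a crossing through a given end:
the sign of the cusp, times the sign of the coloured side. -/
def contribution (col : D.ArcEnd → Side) (e : D.ArcEnd) : ℤ :=
  (col e).toInt * cuspInt (S.cusp? (D.arc e))

variable {S} {col : D.ArcEnd → Side}

/-- Alternation at a classical crossing makes the colours differ exactly across a cusp. -/
lemma toInt_col_join (h : IsColouring col) (e : D.ArcEnd) :
    (col (S.join e)).toInt =
      if (S.cusp? e).isSome then -(col e).toInt else (col e).toInt := by
  obtain ⟨-, hcl, hvi⟩ := h
  obtain ⟨c | c, x⟩ := e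
  · obtain ⟨h1, h2, h3⟩ := hcl c
    have h4 := Side.toInt_of_ne h1
    cases h : S c <;> cases x <;> simp [join, cusp?, h, h2, h3, h4]
  · obtain ⟨h1, h2⟩ := hvi c
    cases x <;> simp [join, cusp?, h1, h2]

/-- The coloured side with respect to the direction of travel does not change along a state
circle. -/
lemma toInt_mul_toInt_col_step (h : IsColouring col) (e : D.ArcEnd) :
    (S.step e).2.toInt * (col (S.step e)).toInt = e.2.toInt * (col e).toInt := by
  rw [toInt_step, step, toInt_col_join h, h.1]
  split_ifs <;> ring

lemma toInt_mul_toInt_col_iterate (h : IsColouring col) (n : ℕ) (e : D.ArcEnd) :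
    (S.step^[n] e).2.toInt * (col (S.step^[n] e)).toInt = e.2.toInt * (col e).toInt := by
  induction n generalizing e with
  | zero => rfl
  | succ n ih => rw [Function.iterate_succ_apply, ih, toInt_mul_toInt_col_step h]

lemma toInt_mul_toInt_col_of_sameCycle (h : IsColouring col) {e e' : D.ArcEnd}
    (he : S.stepPerm.SameCycle e e') :
    e'.2.toInt * (col e').toInt = e.2.toInt * (col e).toInt := by
  obtain ⟨k, rfl⟩ := he.exists_nat_pow_eq
  rw [Equiv.Perm.coe_pow]
  exact toInt_mul_toInt_col_iterate h k e

/-- Reversing the travel swaps the coloured side, which is constant on an orbit; so the two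
directions give disjoint orbits. -/
lemma not_sameCycle_arc (h : IsColouring col) {e e' : D.ArcEnd}
    (he : S.stepPerm.SameCycle e e') : ¬ S.stepPerm.SameCycle e (D.arc e') := by
  intro he'
  have h1 := toInt_mul_toInt_col_of_sameCycle h he
  have h2 := toInt_mul_toInt_col_of_sameCycle h he'
  rw [D.toInt_arc, h.1] at h2
  have h3 : e'.2.toInt * (col e').toInt = 0 := by linarith
  rcases mul_eq_zero.1 h3 with h0 | h0
  · simpa [h0] using e'.2.toInt_mul_self
  · simpa [h0] using (col e').toInt_mul_self

/-- The same cusp read backwards: at a cusp both the colour sign and the cusp sign flip. -/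
lemma contribution_arc_step (h : IsColouring col) (e : D.ArcEnd) :
    S.contribution col (D.arc (S.step e)) = S.contribution col e := by
  rw [contribution, contribution, h.1, D.arc_arc, step, cuspInt_join, toInt_col_join h, h.1]
  cases hc : S.cusp? (D.arc e) <;> simp [cuspInt]

lemma sum_orbit_contribution (h : IsColouring col) (e : D.ArcEnd)
    [DecidablePred (S.stepPerm.SameCycle e)] :
    ∑ a with S.stepPerm.SameCycle e a, S.contribution col a =
      (col e).toInt * altSum (S.cuspWord e) := by
  have key : ∀ a, S.stepPerm.SameCycle e a → S.contribution col a =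
      e.2.toInt * (col e).toInt * (a.2.toInt * cuspInt (S.cusp? (D.arc a))) := by
    intro a ha
    rw [← toInt_mul_toInt_col_of_sameCycle h ha, contribution]
    linear_combination (-(col a).toInt * cuspInt (S.cusp? (D.arc a))) * a.2.toInt_mul_self
  rw [Finset.sum_congr rfl fun a ha => key a (Finset.mem_filter.1 ha).2, ← Finset.mul_sum,
    sum_orbit S e fun a => a.2.toInt * cuspInt (S.cusp? (D.arc a)), sum_iterate_step]
  -- `cuspWord` unfolds to `cuspWordOfLength` at the minimal period.
  change _ * (_ * altSum (S.cuspWord e)) = _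
  linear_combination ((col e).toInt * altSum (S.cuspWord e)) * e.2.toInt_mul_self

lemma sum_reverse_orbit_contribution (h : IsColouring col) (e : D.ArcEnd)
    [DecidablePred (S.stepPerm.SameCycle e)] :
    ∑ a with S.stepPerm.SameCycle e (D.arc a), S.contribution col a =
      ∑ a with S.stepPerm.SameCycle e a, S.contribution col a := by
  symm
  refine Finset.sum_nbij' (fun a => D.arc (S.step a)) (fun a => D.arc (S.step a)) ?_ ?_ ?_ ?_ ?_
  · intro a ha
    simpa [D.arc_arc, sameCycle_step] using ha
  · intro a ha
    rw [Finset.mem_filter] at ha ⊢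
    refine ⟨Finset.mem_univ _, ?_⟩
    rw [← sameCycle_step, step, D.arc_arc, step, join_join]
    exact ha.2
  · intro a _
    simp only [step, D.arc_arc, join_join]
  · intro a _
    simp only [step, D.arc_arc, join_join]
  · intro a _
    exact (contribution_arc_step h a).symm

open scoped Classical in
lemma sum_circle_contribution (h : IsColouring col) (e : D.ArcEnd) :
    ∑ a with S.circleOf a = S.circleOf e, S.contribution col a =
      2 * ((col e).toInt * altSum (S.cuspWord e)) := by
  have hmk : ∀ {a}, S.stepPerm.SameCycle e a → S.circleOf a = S.circleOf e := by
    intro a ha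
    obtain ⟨k, rfl⟩ := ha.exists_nat_pow_eq
    rw [Equiv.Perm.coe_pow]
    induction k with
    | zero => rfl
    | succ k ih =>
      rw [Function.iterate_succ_apply']
      exact (S.circleOf_step _).trans (ih ⟨k, by rw [zpow_natCast, Equiv.Perm.coe_pow]⟩)
  -- The ends on a circle form two orbits, one per direction, with equal sums; hence the factor 2.
  have hunion : ({a | S.circleOf a = S.circleOf e} : Finset D.ArcEnd) =
      ({a | S.stepPerm.SameCycle e a} : Finset D.ArcEnd) ∪
        ({a | S.stepPerm.SameCycle e (D.arc a)} : Finset D.ArcEnd) := by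
    ext a
    simp only [Finset.mem_union, Finset.mem_filter, Finset.mem_univ, true_and]
    refine ⟨fun ha => S.sameCycle_or_of_circleOf_eq ha.symm, ?_⟩
    rintro (ha | ha)
    · exact hmk ha
    · exact (S.circleOf_arc a).symm.trans (hmk ha)
  rw [hunion, Finset.sum_union, sum_reverse_orbit_contribution h, sum_orbit_contribution h]
  · ring
  · refine Finset.disjoint_left.2 fun a ha ha' => ?_
    exact not_sameCycle_arc h (Finset.mem_filter.1 ha).2 (Finset.mem_filter.1 ha').2

lemma sum_corner {M : Type*} [AddCommMonoid M] (f : Corner → M) :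
    ∑ x, f x = f .sw + f .se + f .ne + f .nw := by
  have : (Finset.univ : Finset Corner) = {.sw, .se, .ne, .nw} := rfl
  rw [this]
  simp [add_assoc]

/-- The contributions of all cusps cancel, as those at each crossing do. -/
lemma sum_contribution (h : IsColouring col) : ∑ a, S.contribution col a = 0 := by
  have h1 : ∑ a, S.contribution col a = ∑ a, (col a).toInt * cuspInt (S.cusp? a) := by
    refine Finset.sum_nbij' D.arc D.arc (by simp) (by simp) (fun a _ => D.arc_arc a)
      (fun a _ => D.arc_arc a) fun a _ => ?_
    rw [contribution, h.1]
  rw [h1, Fintype.sum_prod_type]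
  refine Finset.sum_eq_zero fun c _ => ?_
  rw [sum_corner]
  rcases c with c | c
  · obtain ⟨-, h2, h3⟩ := h.2.1 c
    -- In the disoriented case the terms at `sw` and `nw` cancel, as do those at `se` and `ne`.
    cases hS : S c <;> simp [cusp?, hS, cuspInt, Side.toInt, h2, h3]
  · simp [cusp?, cuspInt]

/-! ### Signed indices with zero sum -/

variable (S)

instance : Finite S.Circle := Quot.finite _

noncomputable instance : Fintype S.Circle := Fintype.ofFinite _

/-- The indices of the circle graphs in a state of a checkerboard coloured diagram can be given
signs such that the sum is zero. -/
lemma exists_signed_index (hD : D.CheckerboardColorable) :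
    ∃ u : S.Circle → ℤ, (∀ γ, (u γ).natAbs = S.index (Quot.out γ)) ∧ ∑ γ, u γ = 0 := by
  classical
  obtain ⟨col, h⟩ := hD
  have h : IsColouring col := h
  have hu : ∀ γ : S.Circle, ∃ u : ℤ, u.natAbs = S.index (Quot.out γ) ∧
      -- One factor 2 comes from the two directions, the other from two cusps per unit of index.
      ∑ a with S.circleOf a = γ, S.contribution col a = 4 * u := by
    intro γ
    have h1 := S.natAbs_altSum_cuspWord (Quot.out γ)
    have h2 := sum_circle_contribution (S := S) h (Quot.out γ)
    rw [show S.circleOf (Quot.out γ) = γ from Quot.out_eq γ] at h2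
    rw [h2]
    obtain ⟨w, hw⟩ : (2 : ℤ) ∣ altSum (S.cuspWord (Quot.out γ)) := by omega
    refine ⟨(col (Quot.out γ)).toInt * w, ?_, ?_⟩
    · cases col (Quot.out γ) <;> simp only [Side.toInt] <;> omega
    · rw [hw]; ring
  choose u hu1 hu2 using hu
  refine ⟨u, hu1, ?_⟩
  have h3 := Finset.sum_fiberwise (Finset.univ : Finset D.ArcEnd)
    S.circleOf (S.contribution col)
  rw [sum_contribution h, Finset.sum_congr rfl fun γ _ => hu2 γ, ← Finset.mul_sum] at h3
  simpa using h3

lemma even_sum_index (hD : D.CheckerboardColorable) :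
    Even (∑ γ : S.Circle, S.index (Quot.out γ)) := by
  obtain ⟨u, hu, h0⟩ := S.exists_signed_index hD
  -- Subtracting the zero sum leaves the terms `|u γ| - u γ`, each even.
  rw [← Int.even_coe_nat, Nat.cast_sum, even_iff_two_dvd, ← sub_zero (∑ γ, _), ← h0,
    ← Finset.sum_sub_distrib]
  refine Finset.dvd_sum fun γ _ => ?_
  have := hu γ
  omega

lemma two_mul_index_le (hD : D.CheckerboardColorable) (γ : S.Circle) :
    2 * S.index (Quot.out γ) ≤ ∑ γ : S.Circle, S.index (Quot.out γ) := by
  classical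
  obtain ⟨u, hu, h0⟩ := S.exists_signed_index hD
  simp only [← hu]
  -- Since `u γ` is minus the sum of the others, the triangle inequality bounds its absolute value
  -- by theirs.
  rw [← Finset.add_sum_erase _ _ (Finset.mem_univ γ)] at h0 ⊢
  have h1 := Int.natAbs_sum_le (Finset.univ.erase γ) u
  omega

/-! ### From states to summands -/

/-- The exponent of the monomial `⟨S⟩`. -/
noncomputable def kExponent : ℕ+ →₀ ℕ :=
  ∑ γ : S.Circle, if h : 0 < S.index (Quot.out γ) then Finsupp.single ⟨_, h⟩ 1 else 0

lemma kProduct_eq_monomial : S.kProduct = MvPolynomial.monomial S.kExponent 1 := by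
  rw [kProduct, finprod_eq_prod_of_fintype, kExponent, MvPolynomial.monomial_sum_one]
  refine Finset.prod_congr rfl fun γ _ => ?_
  rw [kVar]
  split_ifs <;> rfl

lemma kDegree_kExponent : kDegree S.kExponent = ∑ γ : S.Circle, S.index (Quot.out γ) := by
  rw [kDegree, kExponent, ← Finsupp.sum_finsetSum_index (by simp) (by intros; ring)]
  refine Finset.sum_congr rfl fun γ _ => ?_
  split_ifs with h
  · exact (Finsupp.sum_single_index (mul_zero _)).trans (mul_one _)
  · rw [Finsupp.sum_zero_index]; omega

lemma exists_index_eq_of_mem_support {i : ℕ+} (hi : i ∈ S.kExponent.support) :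
    ∃ γ : S.Circle, S.index (Quot.out γ) = i := by
  classical
  obtain ⟨γ, -, hγ⟩ := Finset.mem_biUnion.1 (Finsupp.support_finsetSum hi)
  refine ⟨γ, ?_⟩
  split_ifs at hγ with h
  · rw [Finset.mem_singleton.1 (Finsupp.support_single_subset hγ)]; rfl
  · simp at hγ

end State

lemma IsSummand.exists_state {D : VirtualLinkDiagram} {s : ℤ} {m : ℕ+ →₀ ℕ}
    (h : D.IsSummand s m) : ∃ S : D.State, S.kExponent = m := by
  by_contra! hne
  apply h
  -- Each state contributes a scalar multiple of a single K-monomial, so a monomial of no state has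
  -- coefficient zero.
  have h0 : MvPolynomial.coeff m D.arrowPolynomial = 0 := by
    rw [arrowPolynomial, MvPolynomial.coeff_sum]
    refine Finset.sum_eq_zero fun S _ => ?_
    rw [MvPolynomial.coeff_C_mul, State.kProduct_eq_monomial, MvPolynomial.coeff_monomial,
      if_neg (hne S), mul_zero]
  rw [normalizedArrowPolynomial, MvPolynomial.coeff_C_mul, h0, mul_zero]
  rfl

lemma IsSummand.two_mul_le_kDegree {D : VirtualLinkDiagram} (hD : D.CheckerboardColorable) {s : ℤ}
    {m : ℕ+ →₀ ℕ} (h : D.IsSummand s m) {i : ℕ+} (hi : i ∈ m.support) :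
    2 * (i : ℕ) ≤ kDegree m := by
  obtain ⟨S, rfl⟩ := h.exists_state
  obtain ⟨γ, hγ⟩ := S.exists_index_eq_of_mem_support hi
  rw [S.kDegree_kExponent, ← hγ]
  exact S.two_mul_index_le hD γ

end VirtualLinkDiagram

theorem theorem4p1 (D : VirtualLinkDiagram) (hD : D.CheckerboardColorable) :
    (∀ k ∈ D.AS, Even k) ∧
    (∀ (s : ℤ) (m : ℕ+ →₀ ℕ), D.IsSummand s m → ∀ hm : m.support.Nonempty,
      2 * (m.support.max' hm : ℕ) ≤ kDegree m) ∧
    (∀ (s : ℤ) (i : ℕ+), ¬ D.IsSummand s (Finsupp.single i 1)) := by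
  refine ⟨?_, fun s m h hm => h.two_mul_le_kDegree hD (m.support.max'_mem hm), fun s i h => ?_⟩
  · rintro k ⟨s, m, h, rfl⟩
    obtain ⟨S, rfl⟩ := h.exists_state
    rw [S.kDegree_kExponent]
    exact S.even_sum_index hD
  -- For `K_i` alone the bound would read `2 * i ≤ i`.
  · have h1 := h.two_mul_le_kDegree hD (i := i) (by simp)
    have h2 : kDegree (Finsupp.single i 1) = i := by simp [kDegree]
    have := i.pos
    omega
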